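/- Let $d\ge 1$. For a set $\Omega\subset\mathbb{R}^d$ let $\mathcal{B}_\Omega$ be the space of functions $f\in L^2(\mathbb{R}^d)$ whose Fourier transform $\hat f(\omega)=\int f(r)e^{-2\pi i\langle\omega,r\rangle}\,dr$ vanishes almost everywhere outside $\Omega$ (for compact $\Omega$ such functions are taken to be continuous). A trajectory is a continuous curve $\gamma:\mathbb{R}\to\mathbb{R}^d$ that is rectifiable on every bounded interval, and a trajectory set $P$ is a countable collection of trajectories; we also write $P$ for the union of their images. Let $B_a(x)$ be the closed Euclidean ball of radius $a$ centered at $x$, and let $\mathcal{M}^P(a,x)$ be the total arc length of the trajectories of $P$ inside $B_a(x)$. The lower path density of $P$ is $$\ell^-(P)=\liminf_{a\to\infty}\ \inf_{x\in\mathbb{R}^d}\frac{\mathcal{M}^P(a,x)}{|B_a(0)|}.$$ For $A,B>0$ let $\mathrm{Nyq}_\Omega^{A,B}$ be the collection of stable Nyquist trajectory sets for $\mathcal{B}_\Omega$ with stability parameters $A,B$, that is, of all trajectory sets $P$ such that 1. there is a uniformly discrete set $\Lambda\subset P$ with $A\|f\|_2^2\le\sum_{\lambda\in\Lambda}|f(\lambda)|^2\le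 B\|f\|_2^2$ for all $f\in\mathcal{B}_\Omega$; 2. there is a function $\delta\ge 0$ with $\delta(a)=o(a^d)$ as $a\to\infty$ such that for all sufficiently large $a$ and all $x\in\mathbb{R}^d$ there is a continuous rectifiable curve $\alpha:[0,1]\to\mathbb{R}^d$ of length $\mathcal{M}^P(a,x)+\delta(a)$ with $P\cap B_a(x)\subset\alpha([0,1])$. **Theorem.** (a) For every $d\ge1$ there is a constant $C_d>0$, depending only on $d$, such that for every compact set $\Omega\subset\mathbb{R}^d$ with smooth boundary and positive Lebesgue measure $|\Omega|$, and all $A,B>0$, $$\inf_{P\in \mathrm{Nyq}_\Omega^{A,B}}\ell^-(P)\ \ge\ C_d\left(\frac{A\,|\Omega|}{B\,\sigma(\partial\Omega)}\right)^{d-1},$$ where $\sigma(\partial\Omega)$ is the surface measure of $\partial\Omega$. (b) For $\Omega=[-1/2,1/2]^2\subset\mathbb{R}^2$ and all $A,B>0$, $$\inf_{P\in \mathrm{Nyq}_\Omega^{A,B}}\ell^-(P)\ \ge\ \frac{A}{\pi^2\sqrt2\,B}.$$ -/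

import Mathlib

open MeasureTheory Filter Topology Set
open scoped ENNReal ContDiff FourierTransform

namespace MobileSampling

/-- The Euclidean space `ℝ^d`. -/
abbrev Rd (d : ℕ) : Type := EuclideanSpace ℝ (Fin d)

/-! ### Bandlimited functions and stable sampling -/

/-- `f` belongs to the space `B_Ω` of functions in `L²(ℝ^d)` whose Fourier transform
`f̂(ξ) = ∫ f(r) exp(-2πi⟨ξ, r⟩) dr` vanishes almost everywhere outside `Ω`.  For a compact `Ω`
every class in `B_Ω` has exactly one continuous representative; since point values of `f` are
used, `f` is required to be this representative. -/
def IsBandlimited {d : ℕ} (Ω : Set (Rd d)) (f : Rd d → ℂ) : Prop :=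
  Continuous f ∧
    ∃ hf : MemLp f 2 (volume : Measure (Rd d)),
      ∀ᵐ ξ ∂(volume : Measure (Rd d)),
        ξ ∉ Ω → (𝓕 (hf.toLp f) : Lp ℂ 2 (volume : Measure (Rd d))) ξ = 0

/-- `Λ` is uniformly discrete: distinct points have distance more than some fixed `r > 0`. -/
def UniformlyDiscrete {d : ℕ} (Λ : Set (Rd d)) : Prop :=
  ∃ r : ℝ, 0 < r ∧ Λ.Pairwise fun x y => r < dist x y

/-- `Λ` is a set of stable sampling for `B_Ω` with stability parameters `A` and `B`:
`A ‖f‖² ≤ ∑_{λ ∈ Λ} |f(λ)|² ≤ B ‖f‖²` for all `f ∈ B_Ω`. -/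
def IsStableSampling {d : ℕ} (Ω : Set (Rd d)) (A B : ℝ) (Λ : Set (Rd d)) : Prop :=
  ∀ f : Rd d → ℂ, IsBandlimited Ω f →
    ENNReal.ofReal A * eLpNorm f 2 volume ^ 2 ≤ ∑' p : Λ, ‖f p‖ₑ ^ 2 ∧
    ∑' p : Λ, ‖f p‖ₑ ^ 2 ≤ ENNReal.ofReal B * eLpNorm f 2 volume ^ 2

/-! ### Trajectories and their arc length -/

/-- A trajectory: a continuous curve `ℝ → ℝ^d` which is rectifiable on every bounded interval. -/
structure Trajectory (d : ℕ) where
  curve : ℝ → Rd d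
  continuous_curve : Continuous curve
  rectifiable : LocallyBoundedVariationOn curve univ

/-- The arc-length function of a trajectory: for `t ≥ 0` the arc length of the curve restricted to
`[0, t]`, for `t ≤ 0` minus the arc length of the curve restricted to `[t, 0]`. -/
noncomputable def Trajectory.arcLengthFun {d : ℕ} (p : Trajectory d) (t : ℝ) : ℝ :=
  variationOnFromTo p.curve univ 0 t

theorem Trajectory.monotone_arcLengthFun {d : ℕ} (p : Trajectory d) :
    Monotone p.arcLengthFun := fun _ _ h =>
  variationOnFromTo.monotoneOn p.rectifiable (mem_univ 0) (mem_univ _) (mem_univ _) h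

/-- The arc-length measure on the parameter line of a trajectory: the Stieltjes measure of its
(continuous) arc-length function.  It gives `[s, t]` the arc length of the curve on `[s, t]`. -/
noncomputable def Trajectory.arcLengthMeasure {d : ℕ} (p : Trajectory d) : Measure ℝ :=
  p.monotone_arcLengthFun.stieltjesFunction.measure

/-- A trajectory set: a countable collection of trajectories. -/
structure TrajectorySet (d : ℕ) where
  ι : Type
  countable_index : Countable ι
  traj : ι → Trajectory d

/-- The set of all points of `ℝ^d` that lie on some trajectory of `P`. -/
def TrajectorySet.points {d : ℕ} (P : TrajectorySet d) : Set (Rd d) :=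
  ⋃ i, range (P.traj i).curve

/-- `M^P(a, x)`: the total arc length of the trajectories of `P` inside the closed ball of
radius `a` centered at `x`. -/
noncomputable def TrajectorySet.lengthIn {d : ℕ} (P : TrajectorySet d) (a : ℝ) (x : Rd d) : ℝ≥0∞ :=
  ∑' i, (P.traj i).arcLengthMeasure ((P.traj i).curve ⁻¹' Metric.closedBall x a)

/-- The lower path density `ℓ⁻(P) = liminf_{a → ∞} inf_x M^P(a, x) / |B_a|`. -/
noncomputable def TrajectorySet.lowerPathDensity {d : ℕ} (P : TrajectorySet d) : ℝ≥0∞ :=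
  liminf (fun a : ℝ => ⨅ x : Rd d, P.lengthIn a x / volume (Metric.closedBall (0 : Rd d) a)) atTop

/-- Non-degeneracy: there is a nonnegative function `δ(a) = o(a^d)` such that for all sufficiently
large `a` and all `x` some continuous rectifiable curve `α : [0,1] → ℝ^d` of length
`M^P(a, x) + δ(a)` contains the part of `P` inside the closed ball of radius `a` centered at `x`.
(A curve on `[0,1]` is represented by a function on `ℝ` of which only the values on `[0,1]`
matter.) -/
def TrajectorySet.NonDegenerate {d : ℕ} (P : TrajectorySet d) : Prop :=
  ∃ δ : ℝ → ℝ, (∀ a, 0 < a → 0 ≤ δ a) ∧ δ =o[atTop] (fun a : ℝ => a ^ d) ∧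
    ∀ᶠ a : ℝ in atTop, ∀ x : Rd d, ∃ α : ℝ → Rd d,
      ContinuousOn α (Icc 0 1) ∧
      eVariationOn α (Icc 0 1) ≠ ⊤ ∧
      eVariationOn α (Icc 0 1) = P.lengthIn a x + ENNReal.ofReal (δ a) ∧
      P.points ∩ Metric.closedBall x a ⊆ α '' Icc 0 1

/-- The collection of all stable Nyquist trajectory sets for `B_Ω` with stability parameters
`A` and `B`. -/
def Nyq {d : ℕ} (Ω : Set (Rd d)) (A B : ℝ) : Set (TrajectorySet d) :=
  {P | P.NonDegenerate ∧
    ∃ Λ : Set (Rd d), Λ ⊆ P.points ∧ UniformlyDiscrete Λ ∧ IsStableSampling Ω A B Λ}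

/-! ### Spectra -/

/-- `Ω` has smooth boundary: its topological boundary is a smooth embedded hypersurface, i.e.
near each of its points it is the zero set of a smooth function with nonvanishing derivative. -/
def HasSmoothBoundary {d : ℕ} (Ω : Set (Rd d)) : Prop :=
  ∀ p ∈ frontier Ω, ∃ (U : Set (Rd d)) (g : Rd d → ℝ), IsOpen U ∧ p ∈ U ∧
    ContDiffOn ℝ (⊤ : ℕ∞) g U ∧ (∀ x ∈ U, fderiv ℝ g x ≠ 0) ∧
    frontier Ω ∩ U = {x ∈ U | g x = 0}

/-- The surface measure `σ(∂Ω)`: the `(d-1)`-dimensional Hausdorff measure of the boundary,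
normalized so that in `ℝ^{d-1}` it is Lebesgue measure. -/
noncomputable def surfaceMeasure {d : ℕ} (Ω : Set (Rd d)) : ℝ :=
  (Measure.euclideanHausdorffMeasure (d - 1) : Measure (Rd d)).real (frontier Ω)

/-- The square `[-1/2, 1/2]²`. -/
def unitSquare : Set (Rd 2) := {x | ∀ i, x i ∈ Icc (-(1 / 2) : ℝ) (1 / 2)}

end MobileSampling

namespace MobileSampling

/-! ### Bandlimited functions with prescribed spectrum -/

/-! Two facts combine. First, a stable sampling set `Λ` has no large gaps (`gap_bound`). Let `f =
atom Ω x`; its Fourier transform is a modulated indicator of `Ω`, so `‖f‖² = |Ω|`. Multiplying `f`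
by `exp(2πi⟨h, r - x⟩) - 1` replaces the indicator by a difference of translates. This product is
therefore built from atoms of `Ω \ (Ω ± h)`, and the upper sampling bound controls its samples by
`B` times the measure lost under translation. Averaging over `h = s e_j` with `0 ≤ s ≤ S` bounds the
multiplier from below at every point far from `x` in coordinate `j`. If `Λ` missed a large cube
around `x`, all samples of `f` would be small, contradicting `A |Ω| ≤ ∑ |f(λ)|²`.

Second, if every cube of half-side `ρ` meets `P`, then the cubic `ρ`-neighbourhood of the curve from
non-degeneracy covers almost the whole ball. By `volume_tube_le` the curve must be long
(`le_lowerPathDensity`), and the density is at least `2ρ / (4ρ)^d`.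

The loss under translation is computed directly for the square. In general it is at most a constant
times `σ(∂Ω) |s|`, because a point that leaves `Ω` crosses the frontier
(`exists_volume_diff_shift_le_surfaceMeasure`). For `d = 1` the value `2ρ / (4ρ)` does not depend on
`ρ`, so any finite gap size suffices. -/

theorem continuous_neg_innerₗ (d : ℕ) :
    Continuous fun p : Rd d × Rd d => (-innerₗ (Rd d)) p.1 p.2 :=
  (continuous_inner (𝕜 := ℝ) (E := Rd d)).neg

/-- The inverse Fourier transform on `L²` is given by the Fourier integral on `L¹ ∩ L²`. -/
theorem fourierInv_toLp_ae_eq {d : ℕ} {u : Rd d → ℂ} (h1 : Integrable u) (h2 : MemLp u 2 volume) :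
    (𝓕⁻ (h2.toLp u) : Lp ℂ 2 (volume : Measure (Rd d))) =ᵐ[volume] (𝓕⁻ u : Rd d → ℂ) := by
  have hcont : Continuous (𝓕⁻ u : Rd d → ℂ) :=
    VectorFourier.fourierIntegral_continuous Real.continuous_fourierChar
      (continuous_neg_innerₗ d) h1
  refine ae_eq_of_integral_contDiff_smul_eq
    ((Lp.memLp _).locallyIntegrable (by norm_num)) hcont.locallyIntegrable ?_
  intro g hg hgs
  have hg₁ : HasCompactSupport (Complex.ofRealCLM ∘ g) := hgs.comp_left rfl
  have hg₂ : ContDiff ℝ ∞ (Complex.ofRealCLM ∘ g) := by fun_prop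
  set G : SchwartzMap (Rd d) ℂ := hg₁.toSchwartzMap hg₂ with hG
  -- As tempered distributions, the `L²` inverse transform acts by moving the transform onto the
  -- test function; for integrable `u` Fubini then moves it back onto `u`.
  have key := congrArg (fun T => T G) (Lp.fourierInv_toTemperedDistribution_eq (h2.toLp u))
  simp only [TemperedDistribution.fourierInv_apply, Lp.toTemperedDistribution_apply] at key
  have e1 : ∀ x, g x • (𝓕⁻ (h2.toLp u) : Lp ℂ 2 (volume : Measure (Rd d))) x
      = G x • (𝓕⁻ (h2.toLp u) : Lp ℂ 2 (volume : Measure (Rd d))) x := fun x => by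
    simp [hG]
  have e2 : ∀ x, g x • (𝓕⁻ u : Rd d → ℂ) x = G x • (𝓕⁻ u : Rd d → ℂ) x := fun x => by
    simp [hG]
  simp_rw [e1, e2]
  rw [← key]
  have e3 : ∫ x, (𝓕⁻ G) x • (h2.toLp u) x = ∫ x, (𝓕⁻ (G : Rd d → ℂ)) x • u x := by
    refine integral_congr_ae ?_
    filter_upwards [h2.coeFn_toLp] with x hx
    rw [hx]
    rw [SchwartzMap.fourierInv_coe]
  rw [e3]
  have := VectorFourier.integral_fourierIntegral_smul_eq_flip (μ := volume) (ν := volume)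
    (L := -innerₗ (Rd d)) (f := (G : Rd d → ℂ)) (g := u)
    Real.continuous_fourierChar (continuous_neg_innerₗ d) G.integrable h1
  have hflip : (-innerₗ (Rd d)).flip = -innerₗ (Rd d) := by
    ext x y; simp [real_inner_comm]
  rw [hflip] at this
  exact this

theorem isBandlimited_fourierInv {d : ℕ} {Ω : Set (Rd d)} {u : Rd d → ℂ} (h1 : Integrable u)
    (h2 : MemLp u 2 volume) (hu : ∀ ξ, ξ ∉ Ω → u ξ = 0) :
    IsBandlimited Ω (𝓕⁻ u : Rd d → ℂ) := by
  have hcont : Continuous (𝓕⁻ u : Rd d → ℂ) :=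
    VectorFourier.fourierIntegral_continuous Real.continuous_fourierChar
      (continuous_neg_innerₗ d) h1
  have hae := fourierInv_toLp_ae_eq h1 h2
  have hmem : MemLp (𝓕⁻ u : Rd d → ℂ) 2 volume := (memLp_congr_ae hae).1 (Lp.memLp _)
  refine ⟨hcont, hmem, ?_⟩
  have : hmem.toLp (𝓕⁻ u : Rd d → ℂ) = 𝓕⁻ (h2.toLp u) := by
    refine Lp.ext ?_
    exact hmem.coeFn_toLp.trans hae.symm
  rw [this, FourierTransform.fourier_fourierInv_eq]
  filter_upwards [h2.coeFn_toLp] with ξ hξ h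
  rw [hξ, hu ξ h]

theorem eLpNorm_fourierInv {d : ℕ} {u : Rd d → ℂ} (h1 : Integrable u) (h2 : MemLp u 2 volume) :
    eLpNorm (𝓕⁻ u : Rd d → ℂ) 2 volume = eLpNorm u 2 volume := by
  rw [← eLpNorm_congr_ae (fourierInv_toLp_ae_eq h1 h2), ← eLpNorm_congr_ae h2.coeFn_toLp,
    ← Lp.enorm_def, ← Lp.enorm_def]
  have : ‖(𝓕⁻ (h2.toLp u) : Lp ℂ 2 (volume : Measure (Rd d)))‖ = ‖h2.toLp u‖ :=
    (Lp.fourierTransformₗᵢ (Rd d) ℂ).symm.norm_map _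
  rw [← ofReal_norm, ← ofReal_norm, this]

/-- The function with spectrum `E` centred at `x`:
`r ↦ ∫_E exp(2πi⟨ξ, r - x⟩) dξ`. -/
noncomputable def atom {d : ℕ} (E : Set (Rd d)) (x r : Rd d) : ℂ :=
  ∫ ξ in E, (Real.fourierChar (inner ℝ ξ (r - x)) : ℂ)

theorem continuous_phase {d : ℕ} (x : Rd d) :
    Continuous fun ξ : Rd d => (Real.fourierChar (inner ℝ ξ x) : ℂ) :=
  continuous_induced_dom.comp (Real.continuous_fourierChar.comp
    (continuous_id.inner continuous_const))

theorem integrableOn_phase {d : ℕ} {E : Set (Rd d)} (hE' : volume E ≠ ⊤)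
    (x : Rd d) : IntegrableOn (fun ξ : Rd d => (Real.fourierChar (inner ℝ ξ x) : ℂ)) E :=
  Measure.integrableOn_of_bounded (M := 1) hE' (continuous_phase x).aestronglyMeasurable
    (Eventually.of_forall fun _ => (Circle.norm_coe _).le)

theorem atom_eq_fourierInv {d : ℕ} {E : Set (Rd d)} (hE : MeasurableSet E) (x : Rd d) :
    atom E x = 𝓕⁻ (E.indicator fun ξ : Rd d => (Real.fourierChar (inner ℝ ξ (-x)) : ℂ)) := by
  ext r
  rw [Real.fourierInv_eq, atom, ← integral_indicator hE]
  congr 1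
  ext ξ
  by_cases h : ξ ∈ E
  · simp only [indicator_of_mem h, sub_eq_add_neg, inner_add_right, AddChar.map_add_eq_mul,
      Circle.smul_def, smul_eq_mul, Circle.coe_mul]
  · simp [indicator_of_notMem h]

theorem memLp_indicator_phase {d : ℕ} {E : Set (Rd d)} (hE : MeasurableSet E)
    (hE' : volume E ≠ ⊤) (x : Rd d) (p : ℝ≥0∞) :
    MemLp (E.indicator fun ξ : Rd d => (Real.fourierChar (inner ℝ ξ x) : ℂ)) p volume := by
  rw [memLp_indicator_iff_restrict hE]
  have : IsFiniteMeasure (volume.restrict E) := ⟨by simpa using hE'.lt_top⟩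
  exact MemLp.of_bound (continuous_phase x).aestronglyMeasurable 1
    (Eventually.of_forall fun _ => (Circle.norm_coe _).le)

theorem isBandlimited_atom {d : ℕ} {E Ω : Set (Rd d)} (hE : MeasurableSet E)
    (hE' : volume E ≠ ⊤) (hEΩ : E ⊆ Ω) (x : Rd d) : IsBandlimited Ω (atom E x) := by
  rw [atom_eq_fourierInv hE]
  exact isBandlimited_fourierInv (memLp_one_iff_integrable.1 (memLp_indicator_phase hE hE' _ 1))
    (memLp_indicator_phase hE hE' _ 2) fun ξ hξ => indicator_of_notMem (fun h => hξ (hEΩ h)) _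

theorem eLpNorm_atom_sq {d : ℕ} {E : Set (Rd d)} (hE : MeasurableSet E)
    (hE' : volume E ≠ ⊤) (x : Rd d) : eLpNorm (atom E x) 2 volume ^ 2 = volume E := by
  rw [atom_eq_fourierInv hE,
    eLpNorm_fourierInv (memLp_one_iff_integrable.1 (memLp_indicator_phase hE hE' _ 1))
    (memLp_indicator_phase hE hE' _ 2), eLpNorm_indicator_eq_eLpNorm_restrict hE]
  have : eLpNorm (fun ξ : Rd d => (Real.fourierChar (inner ℝ ξ (-x)) : ℂ)) 2 (volume.restrict E)
      = eLpNorm (fun _ : Rd d => (1 : ℝ)) 2 (volume.restrict E) :=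
    eLpNorm_congr_norm_ae (Eventually.of_forall fun _ => by rw [Circle.norm_coe, norm_one])
  rw [this, eLpNorm_const' _ (by norm_num) (by norm_num)]
  rw [enorm_one, one_mul, Measure.restrict_apply_univ, ← ENNReal.rpow_natCast, ← ENNReal.rpow_mul]
  norm_num

/-- The translate `E + h` of a set. -/
def shift {d : ℕ} (h : Rd d) (E : Set (Rd d)) : Set (Rd d) := (fun ξ => ξ - h) ⁻¹' E

theorem measurableSet_shift {d : ℕ} {E : Set (Rd d)} (hE : MeasurableSet E) (h : Rd d) :
    MeasurableSet (shift h E) := (measurable_sub_const h) hE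

theorem volume_shift {d : ℕ} (E : Set (Rd d)) (h : Rd d) : volume (shift h E) = volume E :=
  (measurePreserving_sub_right volume h).measure_preimage_equiv (f := MeasurableEquiv.subRight h) E

theorem atom_shift {d : ℕ} (E : Set (Rd d)) (h x r : Rd d) :
    atom (shift h E) x r = Real.fourierChar (inner ℝ h (r - x)) * atom E x r := by
  have hm : MeasurePreserving (fun ξ : Rd d => ξ - h) volume volume :=
    measurePreserving_sub_right volume h
  have he : MeasurableEmbedding (fun ξ : Rd d => ξ - h) :=
    (MeasurableEquiv.subRight h).measurableEmbedding
  have := hm.setIntegral_preimage_emb he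
    (fun ξ => (Real.fourierChar (inner ℝ (ξ + h) (r - x)) : ℂ)) E
  simp only [sub_add_cancel] at this
  rw [atom, shift, this, atom, ← integral_const_mul]
  congr 1
  ext ξ
  rw [inner_add_left, AddChar.map_add_eq_mul, Circle.coe_mul, mul_comm]

theorem atom_sub_atom {d : ℕ} {E F : Set (Rd d)} (hE : MeasurableSet E) (hF : MeasurableSet F)
    (hE' : volume E ≠ ⊤) (hF' : volume F ≠ ⊤) (x r : Rd d) :
    atom E x r - atom F x r = atom (E \ F) x r - atom (F \ E) x r := by
  simp only [atom]
  rw [← integral_inter_add_sdiff hF (integrableOn_phase hE' (r - x)),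
    ← integral_inter_add_sdiff hE (integrableOn_phase hF' (r - x)), inter_comm F E]
  ring

theorem norm_fourierChar_sub_one_sq (θ : ℝ) :
    ‖(Real.fourierChar θ : ℂ) - 1‖ ^ 2 = 4 * Real.sin (Real.pi * θ) ^ 2 := by
  rw [Real.fourierChar_apply]
  rw [← Complex.normSq_eq_norm_sq, Complex.exp_mul_I, Complex.normSq_apply]
  have h1 : (2 * (Real.pi : ℂ) * θ) = ((2 * (Real.pi * θ) : ℝ) : ℂ) := by push_cast; ring
  simp only [Complex.ofReal_mul, Complex.ofReal_ofNat]
  rw [h1, ← Complex.ofReal_cos, ← Complex.ofReal_sin]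
  simp only [Complex.sub_re, Complex.add_re, Complex.ofReal_re, Complex.mul_re, Complex.I_re,
    Complex.ofReal_im, Complex.I_im, Complex.one_re, Complex.sub_im, Complex.add_im,
    Complex.mul_im, Complex.one_im]
  rw [Real.cos_two_mul, Real.sin_two_mul]
  nlinarith [Real.sin_sq_add_cos_sq (Real.pi * θ)]

/-- The atom of `Ω`, multiplied by the symbol of a difference operator, is controlled by the atoms
of the two one-sided differences of `Ω` and its translates. -/
theorem sin_sq_mul_norm_atom_sq_le {d : ℕ} {Ω : Set (Rd d)} (hΩ : MeasurableSet Ω)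
    (hΩ' : volume Ω ≠ ⊤) (h x r : Rd d) :
    2 * (Real.sin (Real.pi * inner ℝ h (r - x)) ^ 2 * ‖atom Ω x r‖ ^ 2) ≤
      ‖atom (Ω \ shift (-h) Ω) x r‖ ^ 2 + ‖atom (Ω \ shift h Ω) x r‖ ^ 2 := by
  have e1 : ((Real.fourierChar (inner ℝ h (r - x)) : ℂ) - 1) * atom Ω x r =
      atom (shift h Ω \ Ω) x r - atom (Ω \ shift h Ω) x r := by
    rw [← atom_sub_atom (measurableSet_shift hΩ h) hΩ (by rwa [volume_shift]) hΩ', atom_shift]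
    ring
  -- This set lies outside `Ω`, but it is a translate of a subset of `Ω`. Translation only modulates
  -- the atom, so the modulus is that of a function in `B_Ω`.
  have e2 : shift h Ω \ Ω = shift h (Ω \ shift (-h) Ω) := by
    ext ξ; simp [shift]
  have e3 : ‖atom (shift h Ω \ Ω) x r‖ = ‖atom (Ω \ shift (-h) Ω) x r‖ := by
    rw [e2, atom_shift, norm_mul, Circle.norm_coe, one_mul]
  have e4 := congrArg (fun z => ‖z‖ ^ 2) e1
  simp only [norm_mul, mul_pow, norm_fourierChar_sub_one_sq] at e4
  have e5 := norm_sub_le (atom (shift h Ω \ Ω) x r) (atom (Ω \ shift h Ω) x r)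
  rw [e3] at e5
  have e6 := pow_le_pow_left₀ (norm_nonneg _) e5 2
  nlinarith [sq_nonneg (‖atom (Ω \ shift (-h) Ω) x r‖ - ‖atom (Ω \ shift h Ω) x r‖)]

/-! ### Gaps of sampling sets -/

/-- The integral equals `S/2 - sin(cS) cos(cS) / (2c)`; the error is at most `1 / (4|c|) ≤ S/4`.
Averaging is needed because `sin` may vanish at any single `s`. -/
theorem div_four_le_integral_sin_sq {S c : ℝ} (hc : 1 ≤ |c| * S) :
    S / 4 ≤ ∫ s in (0 : ℝ)..S, Real.sin (c * s) ^ 2 := by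
  have hc0 : c ≠ 0 := by rintro rfl; norm_num at hc
  rw [intervalIntegral.integral_comp_mul_left (fun y => Real.sin y ^ 2) hc0, integral_sin_sq]
  have h1 : |Real.sin (c * S) * Real.cos (c * S)| ≤ 1 / 2 := by
    rw [abs_le]
    constructor <;> nlinarith [Real.sin_sq_add_cos_sq (c * S),
      sq_nonneg (Real.sin (c * S) + Real.cos (c * S)),
      sq_nonneg (Real.sin (c * S) - Real.cos (c * S))]
  have h2 : |c⁻¹ * (Real.sin (c * S) * Real.cos (c * S))| ≤ S / 2 := by
    rw [abs_mul, abs_inv, inv_mul_le_iff₀ (abs_pos.2 hc0)]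
    linarith
  have h3 := (abs_le.1 h2).2
  have h4 : c⁻¹ * (c * S) = S := by field_simp
  simp only [mul_zero, Real.sin_zero, smul_eq_mul, zero_mul, zero_sub, sub_zero]
  have h5 : c⁻¹ * ((-(Real.sin (c * S) * Real.cos (c * S)) + c * S) / 2) =
      (c⁻¹ * (c * S) - c⁻¹ * (Real.sin (c * S) * Real.cos (c * S))) / 2 := by ring
  rw [h5, h4]
  linarith

/-- The Bessel bound for atoms, on finite sets of sampling points. -/
theorem sum_norm_atom_sq_le {d : ℕ} {Ω E : Set (Rd d)} {A B b : ℝ} {Λ : Set (Rd d)}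
    (hs : IsStableSampling Ω A B Λ) (hB : 0 ≤ B) (hb : 0 ≤ b) (hE : MeasurableSet E)
    (hEΩ : E ⊆ Ω) (hEb : volume E ≤ ENNReal.ofReal b) (x : Rd d) (T : Finset Λ) :
    ∑ p ∈ T, ‖atom E x p‖ ^ 2 ≤ B * b := by
  have hE' : volume E ≠ ⊤ := (hEb.trans_lt ENNReal.ofReal_lt_top).ne
  have h1 := (hs _ (isBandlimited_atom hE hE' hEΩ x)).2
  rw [eLpNorm_atom_sq hE hE'] at h1
  have h2 : ∑ p ∈ T, ‖atom E x p‖ₑ ^ 2 ≤ ENNReal.ofReal (B * b) := by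
    rw [ENNReal.ofReal_mul hB]
    exact (ENNReal.sum_le_tsum T).trans (h1.trans (by gcongr))
  have h3 : ∑ p ∈ T, ‖atom E x p‖ₑ ^ 2 = ENNReal.ofReal (∑ p ∈ T, ‖atom E x p‖ ^ 2) := by
    rw [ENNReal.ofReal_sum_of_nonneg fun _ _ => by positivity]
    refine Finset.sum_congr rfl fun p _ => ?_
    rw [ENNReal.ofReal_pow (norm_nonneg _), ofReal_norm]
  rw [h3] at h2
  exact (ENNReal.ofReal_le_ofReal_iff (by positivity)).1 h2

/-- If a set of stable sampling for `B_Ω` misses the open cube of half-side `ρ` at `x`, and `Ω`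
loses little measure under short translations, then `A |Ω|` is small in comparison with `B`. -/
theorem gap_bound {d : ℕ} {Ω : Set (Rd d)} {A B κ η S ρ : ℝ} {Λ : Set (Rd d)}
    (hΩ : MeasurableSet Ω) (hΩ' : volume Ω ≠ ⊤) (hs : IsStableSampling Ω A B Λ)
    (hA : 0 ≤ A) (hB : 0 ≤ B) (hS : 0 < S) (hκ : 0 ≤ κ) (hη : 0 ≤ η)
    (hdiff : ∀ (j : Fin d) (s : ℝ), |s| ≤ S →
      volume (Ω \ shift (EuclideanSpace.single j s) Ω) ≤ ENNReal.ofReal (κ * |s| + η))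
    (x : Rd d) (hρ : 1 ≤ Real.pi * ρ * S) (hgap : ∀ p ∈ Λ, ∃ j, ρ ≤ |p j - x j|) :
    A * volume.real Ω ≤ d * (B * (2 * κ * S + 4 * η)) := by
  have hpt : ∀ (T : Finset Λ) (j : Fin d), ∀ s ∈ Icc 0 S,
      ∑ p ∈ T, Real.sin (Real.pi * (p.1 j - x j) * s) ^ 2 * ‖atom Ω x p‖ ^ 2 ≤
        B * (κ * s + η) := by
    intro T j s hsS
    have hb : 0 ≤ κ * s + η := by have := hsS.1; positivity
    -- Needed for `t = s` and `t = -s`, the two one-sided differences in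
    -- `sin_sq_mul_norm_atom_sq_le`.
    have hm : ∀ t : ℝ, |t| = s →
        ∑ p ∈ T, ‖atom (Ω \ shift (EuclideanSpace.single j t) Ω) x p‖ ^ 2 ≤ B * (κ * s + η) := by
      intro t ht
      refine sum_norm_atom_sq_le hs hB hb (hΩ.diff (measurableSet_shift hΩ _)) sdiff_subset ?_ x T
      rw [← ht]
      exact hdiff j t (ht.le.trans hsS.2)
    have h1 := hm s (abs_of_nonneg hsS.1)
    have h2 := hm (-s) (by rw [abs_neg, abs_of_nonneg hsS.1])
    have h3 : ∀ p ∈ T, 2 * (Real.sin (Real.pi * (p.1 j - x j) * s) ^ 2 * ‖atom Ω x p‖ ^ 2) ≤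
        ‖atom (Ω \ shift (EuclideanSpace.single j (-s)) Ω) x p‖ ^ 2 +
        ‖atom (Ω \ shift (EuclideanSpace.single j s) Ω) x p‖ ^ 2 := by
      intro p _
      have h4 := sin_sq_mul_norm_atom_sq_le hΩ hΩ' (EuclideanSpace.single j s) x p.1
      have h5 : inner ℝ (EuclideanSpace.single j s) (p.1 - x) = (p.1 j - x j) * s := by
        rw [EuclideanSpace.inner_single_left]
        simp [mul_comm]
      have h6 : -EuclideanSpace.single j s = EuclideanSpace.single j (-s) := by
        ext i; simp; split_ifs <;> simp
      rw [h5, h6, ← mul_assoc Real.pi] at h4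
      exact h4
    have h7 := Finset.sum_le_sum h3
    rw [← Finset.mul_sum, Finset.sum_add_distrib] at h7
    linarith
  have hfin : ∀ T : Finset Λ, ∑ p ∈ T, ‖atom Ω x p‖ ^ 2 ≤ d * (B * (2 * κ * S + 4 * η)) := by
    intro T
    have hint : ∀ j : Fin d, ∑ p ∈ T,
        (∫ s in (0 : ℝ)..S, Real.sin (Real.pi * (p.1 j - x j) * s) ^ 2) * ‖atom Ω x p‖ ^ 2 ≤
        B * (κ * (S ^ 2 / 2) + η * S) := by
      intro j
      have h1 : ∫ s in (0 : ℝ)..S,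
          ∑ p ∈ T, Real.sin (Real.pi * (p.1 j - x j) * s) ^ 2 * ‖atom Ω x p‖ ^ 2 ≤
          ∫ s in (0 : ℝ)..S, B * (κ * s + η) :=
        intervalIntegral.integral_mono_on hS.le
          (Continuous.intervalIntegrable (by fun_prop) _ _)
          (Continuous.intervalIntegrable (by fun_prop) _ _) (hpt T j)
      rw [intervalIntegral.integral_finsetSum
        fun p _ => Continuous.intervalIntegrable (by fun_prop) _ _] at h1
      simp only [intervalIntegral.integral_mul_const] at h1
      refine h1.trans_eq ?_
      rw [intervalIntegral.integral_const_mul, intervalIntegral.integral_add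
        (Continuous.intervalIntegrable (by fun_prop) _ _)
        (Continuous.intervalIntegrable (by fun_prop) _ _), intervalIntegral.integral_const_mul,
        integral_id, intervalIntegral.integral_const]
      simp only [smul_eq_mul]
      ring
    have h2 := Finset.sum_le_sum (s := Finset.univ) fun j _ => hint j
    rw [Finset.sum_comm, Finset.sum_const, Finset.card_univ, Fintype.card_fin, nsmul_eq_mul] at h2
    -- The coordinate far from `x` depends on `p`; summing over all `j` includes it, at the cost of
    -- the factor `d`.
    have h3 : ∀ p ∈ T, S / 4 * ‖atom Ω x p‖ ^ 2 ≤ ∑ j : Fin d,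
        (∫ s in (0 : ℝ)..S, Real.sin (Real.pi * (p.1 j - x j) * s) ^ 2) * ‖atom Ω x p‖ ^ 2 := by
      intro p _
      obtain ⟨j, hj⟩ := hgap p.1 p.2
      have h4 : S / 4 ≤ ∫ s in (0 : ℝ)..S, Real.sin (Real.pi * (p.1 j - x j) * s) ^ 2 := by
        refine div_four_le_integral_sin_sq (hρ.trans ?_)
        rw [abs_mul, abs_of_pos Real.pi_pos]
        gcongr
      refine (mul_le_mul_of_nonneg_right h4 (by positivity)).trans ?_
      refine Finset.single_le_sum (f := fun j : Fin d => (∫ s in (0 : ℝ)..S,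
        Real.sin (Real.pi * (p.1 j - x j) * s) ^ 2) * ‖atom Ω x p‖ ^ 2) (fun i _ => ?_)
        (Finset.mem_univ j)
      exact mul_nonneg (intervalIntegral.integral_nonneg hS.le fun _ _ => sq_nonneg _)
        (sq_nonneg _)
    have h5 := (Finset.sum_le_sum h3).trans h2
    rw [← Finset.mul_sum] at h5
    have h6 : S / 4 * (d * (B * (2 * κ * S + 4 * η))) =
        d * (B * (κ * (S ^ 2 / 2) + η * S)) := by ring
    rw [← h6] at h5
    exact le_of_mul_le_mul_left h5 (by positivity)
  have h1 := (hs _ (isBandlimited_atom hΩ hΩ' subset_rfl x)).1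
  rw [eLpNorm_atom_sq hΩ hΩ', ENNReal.tsum_eq_iSup_sum] at h1
  have h2 : ENNReal.ofReal A * volume Ω ≤
      ENNReal.ofReal (d * (B * (2 * κ * S + 4 * η))) := by
    refine h1.trans (iSup_le fun T => ?_)
    have h3 : ∑ p ∈ T, ‖atom Ω x p‖ₑ ^ 2 = ENNReal.ofReal (∑ p ∈ T, ‖atom Ω x p‖ ^ 2) := by
      rw [ENNReal.ofReal_sum_of_nonneg fun _ _ => by positivity]
      refine Finset.sum_congr rfl fun p _ => ?_
      rw [ENNReal.ofReal_pow (norm_nonneg _), ofReal_norm]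
    rw [h3]
    exact ENNReal.ofReal_le_ofReal (hfin T)
  rw [← ofReal_measureReal hΩ', ← ENNReal.ofReal_mul hA] at h2
  exact (ENNReal.ofReal_le_ofReal_iff (by positivity)).1 h2

/-! ### Neighbourhoods of curves -/

theorem volume_box {d : ℕ} (l u : Fin d → ℝ) :
    volume {y : Rd d | ∀ j, y j ∈ Icc (l j) (u j)} = ∏ j, ENNReal.ofReal (u j - l j) := by
  have h : {y : Rd d | ∀ j, y j ∈ Icc (l j) (u j)} = WithLp.ofLp ⁻¹' Icc l u := by
    ext y
    simp [Pi.le_def, forall_and]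
  rw [h, (PiLp.volume_preserving_ofLp (Fin d)).measure_preimage
    measurableSet_Icc.nullMeasurableSet, Real.volume_Icc_pi]

/-- A set is no larger than the box spanned by bounds for its coordinate widths. -/
theorem volume_le_prod_of_sub_le {d : ℕ} {E : Set (Rd d)} {w : Fin d → ℝ}
    (hw : ∀ j, ∀ y ∈ E, ∀ z ∈ E, y j - z j ≤ w j) :
    volume E ≤ ∏ j, ENNReal.ofReal (w j) := by
  rcases E.eq_empty_or_nonempty with rfl | ⟨z₀, hz₀⟩
  · simp
  have hbdd : ∀ j, BddBelow ((fun y : Rd d => y j) '' E) := fun j =>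
    ⟨z₀ j - w j, by rintro _ ⟨y, hy, rfl⟩; linarith [hw j z₀ hz₀ y hy]⟩
  have hsub : E ⊆ {y : Rd d | ∀ j, y j ∈ Icc (sInf ((fun y : Rd d => y j) '' E))
      (sInf ((fun y : Rd d => y j) '' E) + w j)} := by
    intro y hy j
    refine ⟨csInf_le (hbdd j) ⟨y, hy, rfl⟩, ?_⟩
    have : y j - w j ≤ sInf ((fun y : Rd d => y j) '' E) :=
      le_csInf ⟨_, z₀, hz₀, rfl⟩ (by rintro _ ⟨z, hz, rfl⟩; linarith [hw j y hy z hz])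
    linarith
  refine (measure_mono hsub).trans_eq ?_
  rw [volume_box]
  simp

theorem abs_apply_sub_le_dist {d : ℕ} (y z : Rd d) (j : Fin d) : |y j - z j| ≤ dist y z := by
  rw [dist_eq_norm, ← Real.norm_eq_abs]
  exact PiLp.norm_apply_le (y - z) j

theorem dist_le_sqrt_mul {d : ℕ} {y z : Rd d} {ρ : ℝ} (hρ : 0 ≤ ρ) (h : ∀ j, |y j - z j| ≤ ρ) :
    dist y z ≤ √d * ρ := by
  rw [EuclideanSpace.dist_eq, ← Real.sqrt_sq hρ, ← Real.sqrt_mul (by positivity)]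
  refine Real.sqrt_le_sqrt ?_
  have : ∀ j ∈ (Finset.univ : Finset (Fin d)), dist (y j) (z j) ^ 2 ≤ ρ ^ 2 := fun j _ =>
    pow_le_pow_left₀ dist_nonneg (by rw [Real.dist_eq]; exact h j) 2
  simpa using Finset.sum_le_sum this

/-- The cubic `ρ`-neighbourhood of a rectifiable curve of length `L` has measure at most
`(L / (2ρ) + 1) (4ρ)^d`. -/
theorem volume_tube_le {d : ℕ} {α : ℝ → Rd d} {L ρ : ℝ} (hL : 0 ≤ L)
    (hα : eVariationOn α (Icc 0 1) = ENNReal.ofReal L) (hρ : 0 < ρ) :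
    volume {y : Rd d | ∃ z ∈ α '' Icc 0 1, ∀ j, |y j - z j| ≤ ρ} ≤
      ENNReal.ofReal ((L / (2 * ρ) + 1) * (4 * ρ) ^ d) := by
  set v : ℝ → ℝ := fun t => (eVariationOn α (Icc 0 t)).toReal with hv
  have hfin : ∀ t ∈ Icc (0 : ℝ) 1, eVariationOn α (Icc 0 t) ≠ ⊤ := fun t ht =>
    ((eVariationOn.mono α (Icc_subset_Icc_right ht.2)).trans_lt
      (hα ▸ ENNReal.ofReal_lt_top)).ne
  have hdist : ∀ s ∈ Icc (0 : ℝ) 1, ∀ t ∈ Icc (0 : ℝ) 1, s ≤ t →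
      v s + dist (α s) (α t) ≤ v t := by
    intro s hs t ht hst
    have h1 := eVariationOn.Icc_add_Icc α (s := univ) hs.1 hst (mem_univ _)
    simp only [univ_inter] at h1
    have h2 : eVariationOn α (Icc 0 s) + edist (α s) (α t) ≤ eVariationOn α (Icc 0 t) := by
      rw [← h1]
      gcongr
      exact eVariationOn.edist_le α (left_mem_Icc.2 hst) (right_mem_Icc.2 hst)
    have h3 := ENNReal.toReal_mono (hfin t ht) h2
    rwa [ENNReal.toReal_add (hfin s hs) (edist_ne_top _ _), ← dist_edist] at h3
  have hvL : ∀ t ∈ Icc (0 : ℝ) 1, v t ≤ L := by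
    intro t ht
    have h1 := ENNReal.toReal_mono (hfin 1 (right_mem_Icc.2 zero_le_one))
      (eVariationOn.mono α (show Icc (0 : ℝ) t ⊆ Icc 0 1 from Icc_subset_Icc_right ht.2))
    rwa [hα, ENNReal.toReal_ofReal hL] at h1
  -- The curve is cut by arc length into pieces of length at most `2ρ`. The neighbourhood of each
  -- has coordinate widths at most `4ρ`: `2ρ` along the piece and `ρ` at either end.
  set U : ℕ → Set (Rd d) := fun k => {y | ∃ t ∈ Icc (0 : ℝ) 1, ⌊v t / (2 * ρ)⌋₊ = k ∧
    ∀ j, |y j - α t j| ≤ ρ} with hU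
  have hUk : ∀ k, volume (U k) ≤ ENNReal.ofReal ((4 * ρ) ^ d) := by
    intro k
    have h1 : volume (U k) ≤ ∏ _j : Fin d, ENNReal.ofReal (4 * ρ) := by
      refine volume_le_prod_of_sub_le ?_
      rintro j y ⟨t, ht, htk, hy⟩ z ⟨s, hs, hsk, hz⟩
      have h2 : |v t - v s| ≤ 2 * ρ := by
        have a1 := Nat.floor_le (show 0 ≤ v t / (2 * ρ) by positivity)
        have a2 := Nat.lt_floor_add_one (v t / (2 * ρ))
        have b1 := Nat.floor_le (show 0 ≤ v s / (2 * ρ) by positivity)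
        have b2 := Nat.lt_floor_add_one (v s / (2 * ρ))
        rw [htk] at a1 a2
        rw [hsk] at b1 b2
        rw [le_div_iff₀ (by positivity)] at a1 b1
        rw [div_lt_iff₀ (by positivity)] at a2 b2
        rw [abs_le]
        constructor <;> linarith
      have h3 : dist (α t) (α s) ≤ 2 * ρ := by
        rcases le_total t s with h | h
        · have := hdist t ht s hs h
          linarith [(abs_le.1 h2).1]
        · have := hdist s hs t ht h
          rw [dist_comm]
          linarith [(abs_le.1 h2).2]
      have h4 := (abs_le.1 ((abs_apply_sub_le_dist (α t) (α s) j).trans h3)).2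
      have h5 := (abs_le.1 (hy j)).2
      have h6 := (abs_le.1 (hz j)).1
      linarith
    simpa [ENNReal.ofReal_pow (show 0 ≤ 4 * ρ by positivity)] using h1
  have hcover : {y : Rd d | ∃ z ∈ α '' Icc 0 1, ∀ j, |y j - z j| ≤ ρ} ⊆
      ⋃ k ∈ Finset.range (⌊L / (2 * ρ)⌋₊ + 1), U k := by
    rintro y ⟨_, ⟨t, ht, rfl⟩, hy⟩
    simp only [mem_iUnion]
    refine ⟨⌊v t / (2 * ρ)⌋₊, ?_, t, ht, rfl, hy⟩
    rw [Finset.mem_range, Nat.lt_succ_iff]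
    exact Nat.floor_le_floor (by have := hvL t ht; gcongr)
  refine (measure_mono hcover).trans ((measure_biUnion_finset_le _ _).trans
    ((Finset.sum_le_sum fun k _ => hUk k).trans ?_))
  rw [Finset.sum_const, Finset.card_range, nsmul_eq_mul, ENNReal.ofReal_mul (by positivity)]
  gcongr
  rw [← ENNReal.ofReal_natCast]
  refine ENNReal.ofReal_le_ofReal ?_
  push_cast
  gcongr
  exact Nat.floor_le (by positivity)

/-- If every closed cube of half-side `ρ` contains a point of `P` and `P` is non-degenerate, then
the lower path density of `P` is at least `2ρ / (4ρ)^d`. -/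
theorem le_lowerPathDensity {d : ℕ} (hd : 1 ≤ d) {P : TrajectorySet d} (hP : P.NonDegenerate)
    {ρ : ℝ} (hρ : 0 < ρ) (hdense : ∀ x : Rd d, ∃ p ∈ P.points, ∀ j, |x j - p j| ≤ ρ) :
    ENNReal.ofReal (2 * ρ / (4 * ρ) ^ d) ≤ P.lowerPathDensity := by
  obtain ⟨δ, hδ0, hδ, hcurve⟩ := hP
  set q : ℝ := 2 * ρ / (4 * ρ) ^ d with hq
  set W : ℝ := volume.real (Metric.ball (0 : Rd d) 1) with hW
  have hW0 : 0 < W := ENNReal.toReal_pos (Metric.measure_ball_pos _ _ one_pos).ne'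
    measure_ball_lt_top.ne
  have hvol : ∀ (x : Rd d) (r : ℝ), 0 ≤ r →
      volume (Metric.closedBall x r) = ENNReal.ofReal (r ^ d * W) := by
    intro x r hr
    rw [Measure.addHaar_closedBall _ _ hr, finrank_euclideanSpace_fin,
      ENNReal.ofReal_mul (by positivity), hW, ofReal_measureReal measure_ball_lt_top.ne]
  set c : ℝ := √d * ρ with hc
  -- The three corrections are the shrinking of the ball by `c`, the extra piece of the tube, and
  -- `δ`; all are negligible against `a ^ d`.
  have hlim : Tendsto (fun a : ℝ => q * W * ((a - c) / a) ^ d - 2 * ρ / a ^ d - δ a / a ^ d)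
      atTop (𝓝 (q * W)) := by
    have h1 : Tendsto (fun a : ℝ => (a - c) / a) atTop (𝓝 1) := by
      have h2 : Tendsto (fun a : ℝ => 1 - c / a) atTop (𝓝 (1 - 0)) :=
        tendsto_const_nhds.sub (tendsto_const_nhds.div_atTop tendsto_id)
      rw [sub_zero] at h2
      refine h2.congr' ?_
      filter_upwards [eventually_gt_atTop 0] with a ha
      field_simp
    have h2 : Tendsto (fun a : ℝ => 2 * ρ / a ^ d) atTop (𝓝 0) :=
      tendsto_const_nhds.div_atTop (tendsto_pow_atTop (by omega))
    have h3 := ((h1.pow d).const_mul (q * W)).sub h2 |>.sub hδ.tendsto_div_nhds_zero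
    simpa using h3
  refine le_of_forall_lt fun e he => ?_
  obtain ⟨e', hee', he'⟩ := exists_between he
  refine hee'.trans_le ?_
  have he'top : e' ≠ ⊤ := (he'.trans ENNReal.ofReal_lt_top).ne
  have he'q : e'.toReal < q := (ENNReal.lt_ofReal_iff_toReal_lt he'top).1 he'
  refine le_liminf_of_le (by isBoundedDefault) ?_
  have hev : ∀ᶠ a : ℝ in atTop,
      e'.toReal * W < q * W * ((a - c) / a) ^ d - 2 * ρ / a ^ d - δ a / a ^ d :=
    hlim.eventually_const_lt (mul_lt_mul_of_pos_right he'q hW0)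
  filter_upwards [hev, hcurve, eventually_gt_atTop 0, eventually_ge_atTop c] with a ha hx ha0 hac
  refine le_iInf fun x => ?_
  obtain ⟨α, -, hfin, hlen, hsub⟩ := hx x
  have hMfin : P.lengthIn a x ≠ ⊤ := by
    rw [hlen] at hfin
    exact (ENNReal.add_ne_top.1 hfin).1
  set M : ℝ := (P.lengthIn a x).toReal with hM
  have hM0 : 0 ≤ M := ENNReal.toReal_nonneg
  have hMeq : P.lengthIn a x = ENNReal.ofReal M := (ENNReal.ofReal_toReal hMfin).symm
  have hδa := hδ0 a ha0
  rw [hMeq, ← ENNReal.ofReal_add hM0 hδa] at hlen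
  have h1 := volume_tube_le (by positivity) hlen hρ
  -- The constant `c = √d ρ` is the Euclidean half-diagonal of the cube, so the point of `P` near
  -- `y` still lies in the ball of radius `a`, hence on `α`.
  have h2 : Metric.closedBall x (a - c) ⊆
      {y : Rd d | ∃ z ∈ α '' Icc 0 1, ∀ j, |y j - z j| ≤ ρ} := by
    intro y hy
    obtain ⟨p, hp, hyp⟩ := hdense y
    refine ⟨p, hsub ⟨hp, ?_⟩, hyp⟩
    have h3 := dist_le_sqrt_mul hρ.le hyp
    rw [Metric.mem_closedBall] at hy ⊢
    have h4 := dist_triangle p y x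
    rw [dist_comm p y] at h4
    linarith
  have h3 := (measure_mono h2).trans h1
  rw [hvol x _ (by linarith), ENNReal.ofReal_le_ofReal_iff (by positivity)] at h3
  have had : 0 < a ^ d := by positivity
  have h4 : q * ((a - c) ^ d * W) ≤ M + δ a + 2 * ρ := by
    have h5 := mul_le_mul_of_nonneg_left h3 (show 0 ≤ q by positivity)
    refine h5.trans_eq ?_
    rw [hq]
    field_simp
  have h5 : e'.toReal * (a ^ d * W) ≤ M := by
    have h6 := mul_lt_mul_of_pos_right ha had
    have h7 : (q * W * ((a - c) / a) ^ d - 2 * ρ / a ^ d - δ a / a ^ d) * a ^ d =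
        q * ((a - c) ^ d * W) - 2 * ρ - δ a := by
      rw [div_pow]
      field_simp
    rw [h7] at h6
    linarith
  rw [ENNReal.le_div_iff_mul_le
    (Or.inl (Metric.measure_closedBall_pos _ _ ha0).ne')
    (Or.inl measure_closedBall_lt_top.ne), hvol _ _ ha0.le, hMeq,
    ← ENNReal.ofReal_toReal he'top, ← ENNReal.ofReal_mul ENNReal.toReal_nonneg]
  exact ENNReal.ofReal_le_ofReal h5

/-! ### The measure lost under translations -/

/-- The lost points fill a slab of width at most `|s|` along one side. The factor is exactly `1`,
which the explicit constant in the planar bound relies on. -/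
theorem volume_unitSquare_diff_shift_le (j : Fin 2) (s : ℝ) :
    volume (unitSquare \ shift (EuclideanSpace.single j s) unitSquare) ≤ ENNReal.ofReal |s| := by
  have key : ∀ y ∈ unitSquare \ shift (EuclideanSpace.single j s) unitSquare,
      (0 ≤ s ∧ y j - s < -(1 / 2)) ∨ (s ≤ 0 ∧ 1 / 2 < y j - s) := by
    rintro y ⟨hy, hys⟩
    have h1 : ¬ ∀ i, y i - EuclideanSpace.single j s i ∈ Icc (-(1 / 2) : ℝ) (1 / 2) := hys
    obtain ⟨i, hi⟩ := not_forall.1 h1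
    have h2 : i = j := by
      by_contra h
      simp only [PiLp.single_apply, h, if_false, sub_zero] at hi
      exact hi (hy i)
    subst h2
    simp only [PiLp.single_apply, if_true, mem_Icc, not_and_or, not_le] at hi
    have h3 := hy i
    rcases hi with hi | hi
    · exact Or.inl ⟨by linarith [h3.1], hi⟩
    · exact Or.inr ⟨by linarith [h3.2], hi⟩
  refine (volume_le_prod_of_sub_le (w := fun i => if i = j then |s| else 1) ?_).trans_eq ?_
  · intro i y hy z hz
    have hyi := hy.1 i
    have hzi := hz.1 i
    split_ifs with h
    · subst h
      rcases key y hy with h1 | h1 <;> rcases key z hz with h2 | h2 <;>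
        linarith [hyi.1, hyi.2, hzi.1, hzi.2, le_abs_self s, neg_abs_le s, h1.1, h1.2, h2.1, h2.2]
    · linarith [hyi.2, hzi.1]
  · simp [apply_ite ENNReal.ofReal]

/-- A short translate of `Ω` lies in a thin closed thickening, whose measure tends to that of `Ω` by
compactness. No boundary regularity enters; this serves the case `d = 1`. -/
theorem exists_volume_diff_shift_le {d : ℕ} {Ω : Set (Rd d)} (hΩ : IsCompact Ω) {η : ℝ}
    (hη : 0 < η) : ∃ S : ℝ, 0 < S ∧ ∀ h : Rd d, ‖h‖ ≤ S →
      volume (Ω \ shift h Ω) ≤ ENNReal.ofReal η := by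
  have h1 := tendsto_measure_cthickening_of_isCompact (μ := (volume : Measure (Rd d))) hΩ
  have hfin := hΩ.measure_lt_top (μ := (volume : Measure (Rd d)))
  have h2 : volume Ω < volume Ω + ENNReal.ofReal η :=
    ENNReal.lt_add_right hfin.ne (by simpa using hη)
  have h3 := h1.eventually_lt_const h2
  obtain ⟨S, hS, hball⟩ := Metric.eventually_nhds_iff.1 h3
  refine ⟨S / 2, by positivity, fun h hh => ?_⟩
  have h4 : volume (Metric.cthickening (S / 2) Ω) ≤ volume Ω + ENNReal.ofReal η :=
    (hball (by rw [Real.dist_eq, sub_zero, abs_of_pos (by positivity)]; linarith)).le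
  have h5 : Ω \ shift h Ω = shift h (shift (-h) Ω \ Ω) := by
    ext ξ; simp [shift]
  rw [h5, volume_shift]
  have h6 : shift (-h) Ω ⊆ Metric.cthickening (S / 2) Ω := by
    intro ξ hξ
    refine Metric.mem_cthickening_of_dist_le ξ (ξ - -h) _ Ω hξ ?_
    simpa [dist_eq_norm] using hh
  refine (measure_mono (sdiff_subset_sdiff_left h6)).trans ?_
  rw [measure_sdiff (Metric.self_subset_cthickening Ω) hΩ.measurableSet.nullMeasurableSet hfin.ne]
  exact tsub_le_iff_left.2 h4

/-- The set of all points `z + τ e_j` with `z ∈ E` and `|τ| ≤ s`. -/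
def sweep {d : ℕ} (j : Fin d) (s : ℝ) (E : Set (Rd d)) : Set (Rd d) :=
  {y | ∃ z ∈ E, ∃ τ : ℝ, |τ| ≤ s ∧ y = z + EuclideanSpace.single j τ}

theorem inter_frontier_nonempty_of_isPreconnected {X : Type*} [TopologicalSpace X] {s t : Set X}
    (ht : IsPreconnected t) (hs : (t ∩ s).Nonempty) (hsc : (t ∩ sᶜ).Nonempty) :
    (t ∩ frontier s).Nonempty := by
  by_contra! h
  have hf : ∀ z ∈ t, z ∉ frontier s := fun z hz hzs =>
    eq_empty_iff_forall_notMem.1 h z ⟨hz, hzs⟩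
  obtain ⟨y, hyt, hys⟩ := hs
  obtain ⟨z, hzt, hzs⟩ := hsc
  have h1 : t ⊆ interior s := by
    refine ht.subset_of_closure_inter_subset isOpen_interior
      ⟨y, hyt, by_contra fun hy => hf y hyt ⟨subset_closure hys, hy⟩⟩ ?_
    rintro w ⟨hw, hwt⟩
    exact by_contra fun hw' => hf w hwt ⟨closure_mono interior_subset hw, hw'⟩
  exact hzs (interior_subset (h1 hzt))

/-- The segment from `y ∈ Ω` to `y - s e_j ∉ Ω` is connected, so it meets the frontier. -/
theorem diff_shift_subset_sweep {d : ℕ} (Ω : Set (Rd d)) (j : Fin d) (s : ℝ) :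
    Ω \ shift (EuclideanSpace.single j s) Ω ⊆ sweep j |s| (frontier Ω) := by
  rintro y ⟨hy, hys⟩
  have hc : IsPreconnected ((fun t : ℝ => y - EuclideanSpace.single j (t * s)) '' Icc 0 1) := by
    refine isPreconnected_Icc.image _ (Continuous.continuousOn ?_)
    have : (fun t : ℝ => y - EuclideanSpace.single j (t * s)) =
        fun t : ℝ => y - t • EuclideanSpace.single j s := by
      ext t i; simp
    rw [this]
    fun_prop
  obtain ⟨_, ⟨t, ht, rfl⟩, hz⟩ := inter_frontier_nonempty_of_isPreconnected (s := Ω) hc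
    ⟨y, ⟨0, by simp, by simp⟩, hy⟩ ⟨_, ⟨1, by simp, rfl⟩, by simpa [shift] using hys⟩
  refine ⟨_, hz, t * s, ?_, by simp⟩
  rw [abs_mul, abs_of_nonneg ht.1]
  exact mul_le_of_le_one_left (abs_nonneg s) ht.2

theorem volume_sweep_le {d : ℕ} (j : Fin d) {s : ℝ} (hs : 0 ≤ s) {E : Set (Rd d)}
    (hE : Metric.ediam E ≠ ⊤) :
    volume (sweep j s E) ≤ Metric.ediam E ^ (d - 1) * (Metric.ediam E + ENNReal.ofReal (2 * s)) := by
  have hb : Bornology.IsBounded E := Metric.isBounded_iff_ediam_ne_top.2 hE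
  refine (volume_le_prod_of_sub_le
    (w := fun i => if i = j then Metric.diam E + 2 * s else Metric.diam E) ?_).trans_eq ?_
  · rintro i _ ⟨y, hy, τ, hτ, rfl⟩ _ ⟨z, hz, τ', hτ', rfl⟩
    have h1 := (abs_le.1 ((abs_apply_sub_le_dist y z i).trans (Metric.dist_le_diam_of_mem hb hy hz))).2
    simp only [PiLp.add_apply, PiLp.single_apply]
    split_ifs with h
    · linarith [(abs_le.1 hτ).2, (abs_le.1 hτ').1]
    · linarith
  · rw [← Finset.mul_prod_erase _ _ (Finset.mem_univ j), mul_comm]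
    have h1 : ∀ i ∈ Finset.univ.erase j, ENNReal.ofReal
        (if i = j then Metric.diam E + 2 * s else Metric.diam E) = Metric.ediam E := by
      intro i hi
      rw [if_neg (Finset.ne_of_mem_erase hi), Metric.diam, ENNReal.ofReal_toReal hE]
    rw [Finset.prod_congr rfl h1, Finset.prod_const, Finset.card_erase_of_mem (Finset.mem_univ j),
      Finset.card_univ, Fintype.card_fin, if_pos rfl,
      ENNReal.ofReal_add Metric.diam_nonneg (by positivity), Metric.diam, ENNReal.ofReal_toReal hE]

/-- Cover `E` by countably many sets of diameter at most `s`. The sweep of each fits in a box with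
`d - 1` sides equal to the diameter and one side at most `s + 2s`; summing gives the Hausdorff sum
of the cover times `3s`. -/
theorem volume_sweep_le_hausdorffMeasure {d : ℕ} (j : Fin d) {s : ℝ} (hs : 0 < s)
    (E : Set (Rd d)) :
    volume (sweep j s E) ≤ Measure.hausdorffMeasure ((d - 1 : ℕ) : ℝ) E * ENNReal.ofReal (3 * s) := by
  have hc0 : ENNReal.ofReal (3 * s) ≠ 0 := by simpa using hs
  rw [← ENNReal.div_le_iff hc0 ENNReal.ofReal_ne_top, Measure.hausdorffMeasure_apply]
  refine le_iSup₂_of_le (ENNReal.ofReal s) (by simpa using hs) ?_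
  refine le_iInf fun t => le_iInf fun ht => le_iInf fun htr => ?_
  rw [ENNReal.div_le_iff hc0 ENNReal.ofReal_ne_top, ← ENNReal.tsum_mul_right]
  have hsub : sweep j s E ⊆ ⋃ n, sweep j s (t n) := by
    rintro y ⟨z, hz, τ, hτ⟩
    obtain ⟨n, hn⟩ := mem_iUnion.1 (ht hz)
    exact mem_iUnion.2 ⟨n, z, hn, τ, hτ⟩
  refine (measure_mono hsub).trans ((measure_iUnion_le _).trans (ENNReal.tsum_le_tsum fun n => ?_))
  rcases (t n).eq_empty_or_nonempty with h | h
  · simp [h, sweep]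
  · rw [iSup_pos h, ENNReal.rpow_natCast]
    refine (volume_sweep_le j hs.le ((htr n).trans_lt ENNReal.ofReal_lt_top).ne).trans ?_
    gcongr
    calc Metric.ediam (t n) + ENNReal.ofReal (2 * s)
        ≤ ENNReal.ofReal s + ENNReal.ofReal (2 * s) := by gcongr; exact htr n
      _ = ENNReal.ofReal (3 * s) := by
        rw [← ENNReal.ofReal_add hs.le (by positivity)]; congr 1; ring

/-- A short translation in a coordinate direction moves a set off itself by at most a constant times
the length of the translation times the surface measure. -/
theorem exists_volume_diff_shift_le_surfaceMeasure (d : ℕ) : ∃ K : ℝ, 0 < K ∧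
    ∀ Ω : Set (Rd d), (Measure.euclideanHausdorffMeasure (d - 1) : Measure (Rd d)) (frontier Ω) ≠ ⊤ →
      ∀ (j : Fin d) (s : ℝ), volume (Ω \ shift (EuclideanSpace.single j s) Ω) ≤
        ENNReal.ofReal (K * surfaceMeasure Ω * |s|) := by
  set c := Measure.addHaarScalarFactor (volume : Measure (Rd (d - 1)))
    (Measure.hausdorffMeasure ((d - 1 : ℕ) : ℝ)) with hc
  have hc0 : c ≠ 0 := Measure.addHaarScalarFactor_volume_hausdorffMeasure_ne_zero (d - 1)
  have hcpos : 0 < (c : ℝ) := by positivity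
  refine ⟨3 / c, by positivity, fun Ω hΩ j s => ?_⟩
  rcases eq_or_ne s 0 with rfl | hs
  · have h0 : (EuclideanSpace.single j (0 : ℝ) : Rd d) = 0 := by ext i; simp
    simp [shift, h0]
  refine (measure_mono (diff_shift_subset_sweep Ω j s)).trans
    ((volume_sweep_le_hausdorffMeasure j (abs_pos.2 hs) _).trans ?_)
  have h1 : (Measure.euclideanHausdorffMeasure (d - 1) : Measure (Rd d)) (frontier Ω) =
      (c : ℝ≥0∞) * Measure.hausdorffMeasure ((d - 1 : ℕ) : ℝ) (frontier Ω) := rfl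
  have h2 : Measure.hausdorffMeasure ((d - 1 : ℕ) : ℝ) (frontier Ω) =
      ENNReal.ofReal (surfaceMeasure Ω / c) := by
    rw [ENNReal.ofReal_div_of_pos hcpos, surfaceMeasure, ofReal_measureReal hΩ, h1,
      ENNReal.ofReal_coe_nnreal, mul_comm,
      ENNReal.mul_div_cancel_right (by simpa using hc0) ENNReal.coe_ne_top]
  have hσ : 0 ≤ surfaceMeasure Ω := measureReal_nonneg
  rw [h2, ← ENNReal.ofReal_mul (div_nonneg hσ hcpos.le)]
  refine ENNReal.ofReal_le_ofReal (le_of_eq ?_)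
  field_simp

/-! ### Lower bounds for the path density -/

/-- Control of the measure which `Ω` loses under translations gives a lower bound for the path
density of all stable Nyquist trajectory sets. -/
theorem le_iInf_lowerPathDensity {d : ℕ} (hd : 1 ≤ d) {Ω : Set (Rd d)} {A B κ η S ρ : ℝ}
    (hΩ : IsCompact Ω) (hA : 0 ≤ A) (hB : 0 ≤ B) (hS : 0 < S) (hκ : 0 ≤ κ) (hη : 0 ≤ η)
    (hdiff : ∀ (j : Fin d) (s : ℝ), |s| ≤ S →
      volume (Ω \ shift (EuclideanSpace.single j s) Ω) ≤ ENNReal.ofReal (κ * |s| + η))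
    (hρ0 : 0 < ρ) (hρ : 1 ≤ Real.pi * ρ * S)
    (hlt : d * (B * (2 * κ * S + 4 * η)) < A * volume.real Ω) :
    ENNReal.ofReal (2 * ρ / (4 * ρ) ^ d) ≤ ⨅ P ∈ Nyq Ω A B, P.lowerPathDensity := by
  refine le_iInf₂ fun P hP => ?_
  obtain ⟨hnd, Λ, hΛP, -, hΛ⟩ := hP
  refine le_lowerPathDensity hd hnd hρ0 fun x => ?_
  by_contra! hx
  refine absurd hlt (not_lt.2 (gap_bound hΩ.measurableSet hΩ.measure_lt_top.ne hΛ hA hB hS hκ hη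
    hdiff x hρ fun p hp => ?_))
  obtain ⟨j, hj⟩ := hx p (hΛP hp)
  exact ⟨j, by rw [abs_sub_comm]; exact hj.le⟩

/-! ### Choice of parameters: the square, `d = 1`, and `d ≥ 2` -/

theorem isCompact_unitSquare : IsCompact unitSquare := by
  refine Metric.isCompact_of_isClosed_isBounded ?_ ?_
  · simp only [unitSquare, ofPred_forall]
    exact isClosed_iInter fun i => isClosed_Icc.preimage (by fun_prop)
  · refine (Metric.isBounded_closedBall (x := (0 : Rd 2)) (r := √(2 : ℕ) * (1 / 2))).subset ?_
    intro x hx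
    refine dist_le_sqrt_mul (by norm_num) fun j => ?_
    have := hx j
    rw [PiLp.zero_apply, sub_zero, abs_le]
    exact this

theorem volume_real_unitSquare : volume.real unitSquare = 1 := by
  rw [measureReal_def, unitSquare, volume_box]
  norm_num

theorem unitSquare_bound {A B : ℝ} (hA : 0 < A) (hB : 0 < B) :
    ENNReal.ofReal (A / (Real.pi ^ 2 * √2 * B)) ≤
      ⨅ P ∈ Nyq unitSquare A B, P.lowerPathDensity := by
  have h2 : (1.414 : ℝ) < √2 := Real.lt_sqrt_of_sq_lt (by norm_num)
  have hpi := Real.pi_gt_d2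
  -- Chosen so that `2ρ / (4ρ)² = 1 / (8ρ)` is the claimed bound. With `S = 1 / (πρ)` the gap
  -- condition reduces to `32 < π³√2`.
  set ρ : ℝ := Real.pi ^ 2 * √2 * B / (8 * A) with hρ
  have hρ0 : 0 < ρ := by positivity
  have h3 : A / (Real.pi ^ 2 * √2 * B) = 2 * ρ / (4 * ρ) ^ 2 := by
    rw [hρ]; field_simp; norm_num
  rw [h3]
  refine le_iInf_lowerPathDensity (κ := 1) (η := 0) (S := 1 / (Real.pi * ρ)) (by norm_num)
    isCompact_unitSquare hA.le hB.le (by positivity) zero_le_one le_rfl ?_ hρ0 ?_ ?_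
  · intro j s _
    simpa using volume_unitSquare_diff_shift_le j s
  · rw [mul_one_div_cancel (by positivity)]
  · rw [volume_real_unitSquare]
    have h4 : ((2 : ℕ) : ℝ) * (B * (2 * 1 * (1 / (Real.pi * ρ)) + 4 * 0)) =
        A * (32 / (Real.pi ^ 3 * √2)) := by
      rw [hρ]; push_cast; field_simp; ring
    rw [h4]
    refine mul_lt_mul_of_pos_left ?_ hA
    rw [div_lt_one (by positivity)]
    have h5 : (3.14 : ℝ) ^ 3 ≤ Real.pi ^ 3 := pow_le_pow_left₀ (by norm_num) hpi.le 3
    nlinarith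

theorem line_bound {d : ℕ} (hd : d = 1) {Ω : Set (Rd d)} (hΩ : IsCompact Ω) (hpos : 0 < volume Ω)
    {A B : ℝ} (hA : 0 < A) (hB : 0 < B) :
    ENNReal.ofReal (1 / 2) ≤ ⨅ P ∈ Nyq Ω A B, P.lowerPathDensity := by
  subst hd
  have hV : 0 < volume.real Ω := ENNReal.toReal_pos hpos.ne' hΩ.measure_lt_top.ne
  -- Makes `4Bη` half of `A |Ω|`, so the gap condition is strict.
  set η : ℝ := A * volume.real Ω / (8 * B) with hη
  have hη0 : 0 < η := by positivity
  obtain ⟨S, hS, hdiff⟩ := exists_volume_diff_shift_le hΩ hη0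
  have h1 : (1 / 2 : ℝ) = 2 * (1 / (Real.pi * S)) / (4 * (1 / (Real.pi * S))) ^ 1 := by
    field_simp; norm_num
  rw [h1]
  refine le_iInf_lowerPathDensity (κ := 0) (η := η) (S := S) le_rfl hΩ hA.le hB.le hS le_rfl
    hη0.le ?_ (by positivity) ?_ ?_
  · intro j s hs
    simpa using hdiff (EuclideanSpace.single j s) (by simpa using hs)
  · field_simp; exact le_rfl
  · have h2 : ((1 : ℕ) : ℝ) * (B * (2 * 0 * S + 4 * η)) = A * volume.real Ω / 2 := by
      rw [hη]; push_cast; field_simp; ring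
    rw [h2]
    linarith [mul_pos hA hV]

theorem surfaceMeasure_bound {d : ℕ} (hd : 2 ≤ d) : ∃ C : ℝ, 0 < C ∧
    ∀ Ω : Set (Rd d), IsCompact Ω → 0 < volume Ω → ∀ A B : ℝ, 0 < A → 0 < B →
      ENNReal.ofReal (C * (A * volume.real Ω / (B * surfaceMeasure Ω)) ^ (d - 1)) ≤
        ⨅ P ∈ Nyq Ω A B, P.lowerPathDensity := by
  obtain ⟨K, hK, hdiff⟩ := exists_volume_diff_shift_le_surfaceMeasure d
  have hd0 : (0 : ℝ) < d := by positivity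
  refine ⟨2 / (4 ^ d * (d * K) ^ (d - 1)), by positivity, fun Ω hΩ hpos A B hA hB => ?_⟩
  have hV : 0 < volume.real Ω := ENNReal.toReal_pos hpos.ne' hΩ.measure_lt_top.ne
  have hσ0 : 0 ≤ surfaceMeasure Ω := measureReal_nonneg
  -- A zero value of `surfaceMeasure`, which by convention includes infinite Hausdorff measure,
  -- makes the quotient `0`; since `d - 1 ≥ 1` the bound is then trivial.
  rcases hσ0.eq_or_lt with h0 | hσ
  · rw [← h0, mul_zero, div_zero, zero_pow (by omega), mul_zero, ENNReal.ofReal_zero]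
    exact zero_le
  have hfin := (ENNReal.toReal_pos_iff.1 hσ).2.ne
  set σ := surfaceMeasure Ω with hσdef
  -- With `S = 1 / (πρ)` the left side of the gap condition becomes `(2/π) A |Ω|`, below `A |Ω|`
  -- because `π > 2`.
  set ρ : ℝ := d * K * (B * σ) / (A * volume.real Ω) with hρ
  have hρ0 : 0 < ρ := by positivity
  have h1 : 2 / (4 ^ d * (d * K) ^ (d - 1)) * (A * volume.real Ω / (B * σ)) ^ (d - 1) =
      2 * ρ / (4 * ρ) ^ d := by
    obtain ⟨n, rfl⟩ : ∃ n, d = n + 1 := ⟨d - 1, by omega⟩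
    have h2 : A * volume.real Ω / (B * σ) = ((n + 1 : ℕ) : ℝ) * K / ρ := by
      rw [hρ]; field_simp
    have hM : 0 < ((n + 1 : ℕ) : ℝ) * K := by positivity
    rw [h2, Nat.add_sub_cancel, div_pow, mul_pow 4 ρ, pow_succ ρ]
    field_simp
  rw [h1]
  refine le_iInf_lowerPathDensity (κ := K * σ) (η := 0) (S := 1 / (Real.pi * ρ)) (by omega) hΩ
    hA.le hB.le (by positivity) (by positivity) le_rfl ?_ hρ0 ?_ ?_
  · intro j s _
    simpa using hdiff Ω hfin j s
  · rw [mul_one_div_cancel (by positivity)]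
  · have h3 : (d : ℝ) * (B * (2 * (K * σ) * (1 / (Real.pi * ρ)) + 4 * 0)) =
        A * volume.real Ω * (2 / Real.pi) := by
      rw [hρ]; field_simp; ring
    rw [h3]
    refine mul_lt_of_lt_one_right (by positivity) ?_
    rw [div_lt_one Real.pi_pos]
    linarith [Real.pi_gt_three]

end MobileSampling

theorem mainTheorem2 :
    (∀ d : ℕ, 1 ≤ d → ∃ C : ℝ, 0 < C ∧
      ∀ Ω : Set (MobileSampling.Rd d), IsCompact Ω → MobileSampling.HasSmoothBoundary Ω →
        0 < volume Ω →
        ∀ A B : ℝ, 0 < A → 0 < B →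
          ENNReal.ofReal
              (C * (A * volume.real Ω / (B * MobileSampling.surfaceMeasure Ω)) ^ (d - 1)) ≤
            ⨅ P ∈ MobileSampling.Nyq Ω A B, P.lowerPathDensity) ∧
    (∀ A B : ℝ, 0 < A → 0 < B →
      ENNReal.ofReal (A / (Real.pi ^ 2 * Real.sqrt 2 * B)) ≤
        ⨅ P ∈ MobileSampling.Nyq MobileSampling.unitSquare A B, P.lowerPathDensity) := by
  refine ⟨fun d hd => ?_, fun A B hA hB => MobileSampling.unitSquare_bound hA hB⟩
  rcases hd.eq_or_lt with h | h
  · refine ⟨1 / 2, by norm_num, fun Ω hΩ _ hpos A B hA hB => ?_⟩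
    have := MobileSampling.line_bound h.symm hΩ hpos hA hB
    simpa [← h] using this
  · obtain ⟨C, hC, hbound⟩ := MobileSampling.surfaceMeasure_bound h
    exact ⟨C, hC, fun Ω hΩ _ hpos A B hA hB => hbound Ω hΩ hpos A B hA hB⟩
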